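/- Let $n,d$ be positive integers and identify $\mathbb R^{2n+3}\cong\mathbb R^3\times\mathbb C^n$ via $z_k=x_{2k+2}+i\,x_{2k+3}$ ($k=1,\dots,n$). Let $p:\mathbb R^3\to\mathbb C$ be a complex-valued homogeneous polynomial of degree $2$ which is harmonic and horizontally conformal, i.e. $$\sum_{k=1}^3\frac{\partial^2p}{\partial x_k^2}=0\quad\text{and}\quad \sum_{k=1}^3\Big(\frac{\partial p}{\partial x_k}\Big)^2=0,$$ and let $P_d,Q_d$ be homogeneous polynomials of degree $d$ in the complex variables $z_1,\dots,z_n$. Set $$\hat\Phi_d(x,z)=\frac{p(x)^{d/2}+P_d(z)}{Q_d(z)},$$ where, for odd $d$, $p^{d/2}=(\sqrt p)^d$ with $\sqrt{\ }$ the principal branch of the square root on $\mathbb C\setminus(-\infty,0]$. Let $\hat U_d\subset\mathbb R^3\times\mathbb C^n$ be the set of all $(x,z)$ with $Q_d(z)\neq0$ and, if $d$ is odd, also $p(x)\notin(-\infty,0]$. Let $S^{2n+2}$ be the unit sphere of $\mathbb R^{2n+3}$ with its round metric, $\pi:\mathbb R^{2n+3}\setminus\{0\}\to S^{2n+2}$,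 $\pi(y)=y/|y|$, the radial projection. Then $0\notin\hat U_d$; the set $\hat U_d$ and the map $\hat\Phi_d$ are invariant under $y\mapsto\lambda y$ for every real $\lambda>0$; the set $U_d=\pi(\hat U_d)$ is open in $S^{2n+2}$; and there is a (necessarily unique) map $\Phi_d:U_d\to\mathbb C$ with $\Phi_d\circ\pi=\hat\Phi_d$ on $\hat U_d$. This map $\Phi_d$ is smooth and is a harmonic morphism: for every harmonic function $f:W\to\mathbb R$ on an open set $W\subset\mathbb C$, the composition $f\circ\Phi_d$ is a harmonic function (with respect to the Laplace-Beltrami operator of the round metric) on $\Phi_d^{-1}(W)\subset S^{2n+2}$. -/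

import Mathlib

open scoped Manifold ContDiff

noncomputable section

namespace SphereHM

/-! ### Riemannian Laplacian and harmonic morphisms into `ℂ` -/

section Riemannian

variable {m : ℕ} {M : Type*} [TopologicalSpace M] [ChartedSpace (EuclideanSpace ℝ (Fin m)) M]

/-- A field of bilinear forms on the tangent spaces of an `m`-dimensional manifold. -/
abbrev TensorField (m : ℕ) (M : Type*) [TopologicalSpace M]
    [ChartedSpace (EuclideanSpace ℝ (Fin m)) M] : Type _ :=
  (x : M) → LinearMap.BilinForm ℝ (TangentSpace (𝓡 m) x)

/-- The coordinate vector field `∂/∂uᵢ` of the preferred chart at `x₀`, at the point with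
coordinates `u`. -/
def coordVector (x₀ : M) (i : Fin m) (u : EuclideanSpace ℝ (Fin m)) :
    TangentSpace (𝓡 m) ((extChartAt (𝓡 m) x₀).symm u) :=
  mfderiv (𝓡 m) (𝓡 m) (extChartAt (𝓡 m) x₀).symm u (EuclideanSpace.single i (1 : ℝ))

/-- The matrix `gᵢⱼ(u) = g(∂/∂uᵢ, ∂/∂uⱼ)` in the preferred chart at `x₀`. -/
def metricMatrix (g : TensorField m M) (x₀ : M) (u : EuclideanSpace ℝ (Fin m)) :
    Matrix (Fin m) (Fin m) ℝ :=
  Matrix.of fun i j =>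
    g ((extChartAt (𝓡 m) x₀).symm u) (coordVector x₀ i u) (coordVector x₀ j u)

/-- The Laplace-Beltrami operator
`Δ f = |g|^(-1/2) ∑ᵢ ∂ᵢ (|g|^(1/2) ∑ⱼ gⁱʲ ∂ⱼ f)`, computed at `x₀` in the preferred chart
at `x₀`. -/
def laplaceBeltrami (g : TensorField m M) (f : M → ℝ) (x₀ : M) : ℝ :=
  (√(metricMatrix g x₀ (extChartAt (𝓡 m) x₀ x₀)).det)⁻¹ *
    ∑ i : Fin m,
      fderiv ℝ
        (fun u : EuclideanSpace ℝ (Fin m) =>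
          √(metricMatrix g x₀ u).det *
            ∑ j : Fin m, (metricMatrix g x₀ u)⁻¹ i j *
              fderiv ℝ (f ∘ (extChartAt (𝓡 m) x₀).symm) u (EuclideanSpace.single j 1))
        (extChartAt (𝓡 m) x₀ x₀) (EuclideanSpace.single i 1)

/-- `f` is a harmonic function on the open subset `V` of `(M, g)`. -/
def IsHarmonicOn (g : TensorField m M) (f : M → ℝ) (V : Set M) : Prop :=
  ContMDiffOn (𝓡 m) 𝓘(ℝ, ℝ) 2 f V ∧ ∀ x ∈ V, laplaceBeltrami g f x = 0

/-- The smooth map `φ : V → ℂ`, defined on the open subset `V` of `(M, g)`, is a harmonic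
morphism: it pulls back harmonic functions, defined on open subsets `W` of `ℂ`, to harmonic
functions. -/
def IsHarmonicMorphismOn (g : TensorField m M) (φ : M → ℂ) (V : Set M) : Prop :=
  ContMDiffOn (𝓡 m) 𝓘(ℝ, ℂ) ∞ φ V ∧
    ∀ (W : Set ℂ) (f : ℂ → ℝ), IsOpen W → InnerProductSpace.HarmonicOnNhd f W →
      IsHarmonicOn g (f ∘ φ) (V ∩ φ ⁻¹' W)

end Riemannian

/-! ### The round sphere -/

/-- The unit sphere of dimension `m` in `ℝ^(m+1)`. -/
abbrev Sphere (m : ℕ) : Type := Metric.sphere (0 : EuclideanSpace ℝ (Fin (m + 1))) 1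

/-- The differential of the inclusion of the sphere in Euclidean space. -/
def inclDeriv (m : ℕ) (x : Sphere m) :
    TangentSpace (𝓡 m) x →L[ℝ] EuclideanSpace ℝ (Fin (m + 1)) :=
  mfderiv (𝓡 m) 𝓘(ℝ, EuclideanSpace ℝ (Fin (m + 1)))
    (fun y : Sphere m => (y : EuclideanSpace ℝ (Fin (m + 1)))) x

/-- The round metric: the metric induced from Euclidean space. -/
def roundMetric (m : ℕ) : TensorField m (Sphere m) := fun x =>
  (innerₗ (EuclideanSpace ℝ (Fin (m + 1)))).compl₁₂
    (inclDeriv m x).toLinearMap (inclDeriv m x).toLinearMap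

/-- The radial projection `x ↦ x / |x|` of `ℝ^(m+1) ∖ {0}` onto the sphere. -/
def radialProj (m : ℕ) (x : {x : EuclideanSpace ℝ (Fin (m + 1)) // x ≠ 0}) : Sphere m :=
  ⟨‖x.1‖⁻¹ • x.1, by
    rw [mem_sphere_zero_iff_norm, norm_smul, norm_inv, norm_norm,
      inv_mul_cancel₀ (norm_ne_zero_iff.2 x.2)]⟩

/-! ### The maps on `ℝ³ × ℂⁿ` -/

/-- `p` is a (complex-valued) harmonic homogeneous polynomial of degree two on `ℝ³` which is
horizontally conformal: `τ(p) = ∑ ∂²p/∂xₖ² = 0` and `κ(p, p) = ∑ (∂p/∂xₖ)² = 0`. -/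
structure IsConformalHarmonicQuadratic (p : MvPolynomial (Fin 3) ℂ) : Prop where
  homogeneous : p.IsHomogeneous 2
  harmonic : ∑ k, MvPolynomial.pderiv k (MvPolynomial.pderiv k p) = 0
  conformal : ∑ k, MvPolynomial.pderiv k p * MvPolynomial.pderiv k p = 0

variable (n d : ℕ) (p : MvPolynomial (Fin 3) ℂ) (P Q : MvPolynomial (Fin n) ℂ)

/-- The identification `ℝ^(2n+3) ≅ ℝ³ × ℂⁿ`, first component: the (zero-based) coordinates
`0, 1, 2`, as complex numbers. -/
def realPart (x : EuclideanSpace ℝ (Fin (2 * n + 2 + 1))) : Fin 3 → ℂ :=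
  fun k => (x ⟨k, by omega⟩ : ℂ)

/-- The identification `ℝ^(2n+3) ≅ ℝ³ × ℂⁿ`, second component: the `k`-th complex coordinate
is made of the (zero-based) real coordinates `2k+3` and `2k+4`. -/
def complexPart (x : EuclideanSpace ℝ (Fin (2 * n + 2 + 1))) : Fin n → ℂ :=
  fun k => (x ⟨2 * k + 3, by omega⟩ : ℂ) + (x ⟨2 * k + 4, by omega⟩ : ℂ) * Complex.I

/-- `w^(d/2)`: a power of `w` for even `d`, a power of the principal square root of `w` for
odd `d`. -/
def halfPow (w : ℂ) : ℂ :=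
  if Even d then w ^ (d / 2) else (w ^ (1 / 2 : ℂ)) ^ d

/-- The domain of `(p^(d/2) + P) / Q`: the points `(x, z)` with `Q(z) ≠ 0` and, for odd `d`,
with `p(x)` not in `(-∞, 0]`. -/
def hatDomain : Set (EuclideanSpace ℝ (Fin (2 * n + 2 + 1))) :=
  {x | MvPolynomial.eval (complexPart n x) Q ≠ 0 ∧
    (Odd d → MvPolynomial.eval (realPart n x) p ∈ Complex.slitPlane)}

/-- The function `(x, z) ↦ (p(x)^(d/2) + P(z)) / Q(z)`. -/
def hatPhi (x : EuclideanSpace ℝ (Fin (2 * n + 2 + 1))) : ℂ :=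
  (halfPow d (MvPolynomial.eval (realPart n x) p) + MvPolynomial.eval (complexPart n x) P) /
    MvPolynomial.eval (complexPart n x) Q

/-- The image of the domain under the radial projection, a subset of `S^(2n+2)`. -/
def sphereDomain : Set (Sphere (2 * n + 2)) :=
  radialProj (2 * n + 2) '' {x | x.1 ∈ hatDomain n d p Q}

/-- `Φ` is induced on the sphere by `(p^(d/2) + P) / Q`, that is `Φ ∘ π = (p^(d/2) + P) / Q`
on the domain of the latter. (The values of `Φ` outside `sphereDomain` play no role.) -/
def IsInducedMap (Φ : Sphere (2 * n + 2) → ℂ) : Prop :=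
  ∀ x : {x : EuclideanSpace ℝ (Fin (2 * n + 2 + 1)) // x ≠ 0}, x.1 ∈ hatDomain n d p Q →
    Φ (radialProj (2 * n + 2) x) = hatPhi n d p P Q x.1

end SphereHM

end

/-!
The map factors as `R ∘ φ`, where `φ(x, z) = (p(x), z)` and `R(w, z) = (w^(d/2) + P(z)) / Q(z)` is
holomorphic. The components of `φ` are harmonic, and conformality of `p` gives
`∑ᵢ ∂ᵢφⱼ ∂ᵢφₖ = 0` for all `j` and `k`, so by the chain rule holomorphic functions of `φ` are
Euclidean-harmonic. A harmonic `f` on an open subset of `ℂ` is locally the real part of a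
holomorphic `F`; therefore `f ∘ R ∘ φ`, locally the real part of `F ∘ R ∘ φ`, is harmonic on an open
subset of `ℝ^(2n+3)`.

This function is homogeneous of degree zero, so it has no radial derivatives, and at a point `x` of
the sphere its Euclidean Laplacian equals the spherical Laplacian of its restriction. In the
stereographic chart centred at `x` both are computed by the coordinate Laplacian at the origin,
since the conformal factor of the chart is stationary there.
-/

noncomputable section

open InnerProductSpace
open scoped Topology Laplacian

namespace SphereHM

section Laplacian

variable {𝕜 E F G : Type*} [NontriviallyNormedField 𝕜]
  [NormedAddCommGroup E] [NormedAddCommGroup F] [NormedAddCommGroup G]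

theorem fderiv_fderiv_comp_apply [NormedSpace 𝕜 E] [NormedSpace 𝕜 F] [NormedSpace 𝕜 G]
    {g : F → G} {φ : E → F} {x : E}
    (hg : ContDiffAt 𝕜 2 g (φ x)) (hφ : ContDiffAt 𝕜 2 φ x) (v w : E) :
    fderiv 𝕜 (fderiv 𝕜 (g ∘ φ)) x v w =
      fderiv 𝕜 (fderiv 𝕜 g) (φ x) (fderiv 𝕜 φ x v) (fderiv 𝕜 φ x w) +
        fderiv 𝕜 g (φ x) (fderiv 𝕜 (fderiv 𝕜 φ) x v w) := by
  have hchain : fderiv 𝕜 (g ∘ φ) =ᶠ[𝓝 x] fun y => (fderiv 𝕜 g (φ y)).comp (fderiv 𝕜 φ y) := by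
    filter_upwards [hφ.eventually (by simp), hφ.continuousAt.eventually (hg.eventually (by simp))]
      with y hφy hgy
    exact fderiv_comp y (hgy.differentiableAt two_ne_zero) (hφy.differentiableAt two_ne_zero)
  have hDg : DifferentiableAt 𝕜 (fderiv 𝕜 g) (φ x) :=
    (hg.fderiv_right (m := 1) le_rfl).differentiableAt one_ne_zero
  have hDφ : DifferentiableAt 𝕜 (fderiv 𝕜 φ) x :=
    (hφ.fderiv_right (m := 1) le_rfl).differentiableAt one_ne_zero
  have hprod : HasFDerivAt (fun y => (fderiv 𝕜 g (φ y)).comp (fderiv 𝕜 φ y)) _ x :=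
    (hDg.hasFDerivAt.comp x (hφ.differentiableAt two_ne_zero).hasFDerivAt).clm_comp
      hDφ.hasFDerivAt
  rw [hchain.fderiv_eq, hprod.fderiv]
  simp [add_comm]

variable {ι : Type*} [Fintype ι] [InnerProductSpace ℝ E] [FiniteDimensional ℝ E]
  [NormedSpace ℝ F] [NormedSpace ℝ G]

theorem laplacian_eq_sum_fderiv_fderiv (b : OrthonormalBasis ι ℝ E) (φ : E → F) (x : E) :
    Δ φ x = ∑ i, fderiv ℝ (fderiv ℝ φ) x (b i) (b i) := by
  simp [laplacian_eq_iteratedFDeriv_orthonormalBasis φ b, iteratedFDeriv_two_apply]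

theorem laplacian_comp (b : OrthonormalBasis ι ℝ E) {g : F → G} {φ : E → F} {x : E}
    (hg : ContDiffAt ℝ 2 g (φ x)) (hφ : ContDiffAt ℝ 2 φ x) :
    Δ (g ∘ φ) x =
      ∑ i, fderiv ℝ (fderiv ℝ g) (φ x) (fderiv ℝ φ x (b i)) (fderiv ℝ φ x (b i)) +
        fderiv ℝ g (φ x) (Δ φ x) := by
  simp only [laplacian_eq_sum_fderiv_fderiv b, fderiv_fderiv_comp_apply hg hφ,
    Finset.sum_add_distrib, map_sum]

theorem laplacian_continuousLinearMap (L : E →L[ℝ] F) (x : E) : Δ (L : E → F) x = 0 := by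
  have hL : fderiv ℝ (L : E → F) = fun _ => L := funext fun y => L.fderiv
  simp [laplacian_eq_sum_fderiv_fderiv (stdOrthonormalBasis ℝ E), hL]

theorem laplacian_prodMk {φ : E → F} {ψ : E → G} {x : E} (hφ : ContDiffAt ℝ 2 φ x)
    (hψ : ContDiffAt ℝ 2 ψ x) : Δ (fun y => (φ y, ψ y)) x = (Δ φ x, Δ ψ x) :=
  Prod.ext
    ((hφ.prodMk hψ).laplacian_CLM_comp_left (l := ContinuousLinearMap.fst ℝ F G)).symm
    ((hφ.prodMk hψ).laplacian_CLM_comp_left (l := ContinuousLinearMap.snd ℝ F G)).symm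

end Laplacian

section Isotropic

variable {E V ι : Type*} [NormedAddCommGroup E] [InnerProductSpace ℝ E] [FiniteDimensional ℝ E]
  [NormedAddCommGroup V] [NormedSpace ℂ V] [Fintype ι]

theorem fderiv_fderiv_restrictScalars_apply {h : V → ℂ} {z : V} (hh : AnalyticAt ℂ h z) (v w : V) :
    fderiv ℝ (fderiv ℝ h) z v w = fderiv ℂ (fderiv ℂ h) z v w := by
  simpa [iteratedFDeriv_two_apply] using
    (congrArg (fun A => A ![v, w])
      ((hh.contDiffAt (n := 2)).restrictScalars_iteratedFDeriv (𝕜 := ℝ))).symm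

/-- The map `φ` is isotropic at `x`: its partial derivatives in an orthonormal basis satisfy
`∑ᵢ ∂ᵢφ ⊗ ∂ᵢφ = 0`, tested against complex bilinear forms. For a complex-valued function this is
horizontal conformality, `κ(φ, φ) = ∑ᵢ (∂ᵢφ)² = 0`; for a `ℂⁿ`-valued map it says that
`κ(φⱼ, φₖ) = 0` for all components. -/
def IsIsotropicAt (b : OrthonormalBasis ι ℝ E) (φ : E → V) (x : E) : Prop :=
  ∀ B : V →L[ℂ] V →L[ℂ] ℂ, ∑ i, B (fderiv ℝ φ x (b i)) (fderiv ℝ φ x (b i)) = 0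

theorem laplacian_comp_eq_zero {b : OrthonormalBasis ι ℝ E} {φ : E → V} {x : E} {h : V → ℂ}
    (hφ : ContDiffAt ℝ 2 φ x) (hharm : Δ φ x = 0) (hiso : IsIsotropicAt b φ x)
    (hh : AnalyticAt ℂ h (φ x)) :
    Δ (h ∘ φ) x = 0 := by
  have hhℝ : ContDiffAt ℝ 2 h (φ x) := (hh.contDiffAt (n := 2)).restrict_scalars ℝ
  rw [laplacian_comp b hhℝ hφ, hharm, map_zero, add_zero]
  simpa only [fderiv_fderiv_restrictScalars_apply hh] using hiso (fderiv ℂ (fderiv ℂ h) (φ x))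

theorem exists_analyticAt_re_eventuallyEq {f : ℂ → ℝ} {z : ℂ} (hf : HarmonicAt f z) :
    ∃ F : ℂ → ℂ, AnalyticAt ℂ F z ∧ (fun w => (F w).re) =ᶠ[𝓝 z] f := by
  obtain ⟨r, hr, hball⟩ := Metric.eventually_nhds_iff_ball.1 hf.eventually
  obtain ⟨F, hF, hFf⟩ := HarmonicOnNhd.exists_analyticOnNhd_ball_re_eq hball
  exact ⟨F, hF z (Metric.mem_ball_self hr), hFf.eventuallyEq_of_mem (Metric.ball_mem_nhds z hr)⟩

theorem laplacian_harmonic_comp_eq_zero {b : OrthonormalBasis ι ℝ E} {φ : E → V} {x : E}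
    {R : V → ℂ} {f : ℂ → ℝ} (hφ : ContDiffAt ℝ 2 φ x) (hharm : Δ φ x = 0)
    (hiso : IsIsotropicAt b φ x) (hR : AnalyticAt ℂ R (φ x)) (hf : HarmonicAt f (R (φ x))) :
    Δ (f ∘ R ∘ φ) x = 0 := by
  obtain ⟨F, hF, hFf⟩ := exists_analyticAt_re_eventuallyEq hf
  have hFR : AnalyticAt ℂ (F ∘ R) (φ x) := hF.comp hR
  have hre : f ∘ R ∘ φ =ᶠ[𝓝 x] Complex.reCLM ∘ (F ∘ R) ∘ φ :=
    ((hR.continuousAt.comp hφ.continuousAt).eventually hFf).mono fun _ h => h.symm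
  have hsmooth : ContDiffAt ℝ 2 ((F ∘ R) ∘ φ) x := hFR.restrictScalars.contDiffAt.comp x hφ
  rw [(laplacian_congr_nhds hre).self_of_nhds, hsmooth.laplacian_CLM_comp_left,
    Function.comp_apply, laplacian_comp_eq_zero hφ hharm hiso hFR, map_zero]

end Isotropic

section ConformalChart

variable {m : ℕ} {M : Type*} [TopologicalSpace M] [ChartedSpace (EuclideanSpace ℝ (Fin m)) M]

theorem sqrt_det_mul_sum_inv_smul_one_mul {a : ℝ} (ha : a ≠ 0) (v : Fin m → ℝ) (i : Fin m) :
    √(a • (1 : Matrix (Fin m) (Fin m) ℝ)).det *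
      ∑ j, (a • (1 : Matrix (Fin m) (Fin m) ℝ))⁻¹ i j * v j = √(a ^ m) * a⁻¹ * v i := by
  have hinv : (a • (1 : Matrix (Fin m) (Fin m) ℝ))⁻¹ = a⁻¹ • 1 :=
    Matrix.inv_eq_right_inv (by simp [smul_smul, ha])
  simp [hinv, Matrix.one_apply, mul_assoc]

/-- In a conformal chart `√|g| gⁱʲ = (√(cᵐ) / c) δᵢⱼ`; where `c` is stationary, so is this weight,
and no first-order term is left. -/
theorem laplaceBeltrami_eq_laplacian_of_metricMatrix_eq_smul {g : TensorField m M} {f : M → ℝ}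
    {x₀ : M} {c : EuclideanSpace ℝ (Fin m) → ℝ}
    (hg : ∀ᶠ u in 𝓝 (extChartAt (𝓡 m) x₀ x₀), metricMatrix g x₀ u = c u • 1)
    (hpos : 0 < c (extChartAt (𝓡 m) x₀ x₀))
    (hc : HasFDerivAt c (0 : _ →L[ℝ] ℝ) (extChartAt (𝓡 m) x₀ x₀))
    (hf : ContDiffAt ℝ 2 (f ∘ (extChartAt (𝓡 m) x₀).symm) (extChartAt (𝓡 m) x₀ x₀)) :
    laplaceBeltrami g f x₀ = (c (extChartAt (𝓡 m) x₀ x₀))⁻¹ *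
      Δ (f ∘ (extChartAt (𝓡 m) x₀).symm) (extChartAt (𝓡 m) x₀ x₀) := by
  unfold laplaceBeltrami
  set u₀ := extChartAt (𝓡 m) x₀ x₀
  set F := f ∘ (extChartAt (𝓡 m) x₀).symm
  have hflux (i : Fin m) :
      (fun u => √(metricMatrix g x₀ u).det * ∑ j, (metricMatrix g x₀ u)⁻¹ i j *
        fderiv ℝ F u (EuclideanSpace.single j 1)) =ᶠ[𝓝 u₀]
      fun u => (√(c u ^ m) * (c u)⁻¹) * fderiv ℝ F u (EuclideanSpace.single i 1) := by
    filter_upwards [hg, hc.continuousAt.eventually_ne hpos.ne'] with u hu hcu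
    simp only [hu, sqrt_det_mul_sum_inv_smul_one_mul hcu]
  have hweight : HasFDerivAt (fun u => √(c u ^ m) * (c u)⁻¹) (0 : _ →L[ℝ] ℝ) u₀ := by
    have hdiff : DifferentiableAt ℝ (fun s : ℝ => √(s ^ m) * s⁻¹) (c u₀) :=
      ((differentiableAt_pow m).sqrt (pow_ne_zero m hpos.ne')).mul (differentiableAt_inv hpos.ne')
    have hcomp := hdiff.hasDerivAt.comp_hasFDerivAt u₀ hc
    rwa [smul_zero] at hcomp
  have hDF : DifferentiableAt ℝ (fderiv ℝ F) u₀ :=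
    (hf.fderiv_right (m := 1) le_rfl).differentiableAt one_ne_zero
  have hdiv (i : Fin m) :
      fderiv ℝ (fun u => (√(c u ^ m) * (c u)⁻¹) * fderiv ℝ F u (EuclideanSpace.single i 1)) u₀
        (EuclideanSpace.single i 1) = (√(c u₀ ^ m) * (c u₀)⁻¹) *
          fderiv ℝ (fderiv ℝ F) u₀ (EuclideanSpace.single i 1) (EuclideanSpace.single i 1) := by
    have hprod : HasFDerivAt (fun u => (√(c u ^ m) * (c u)⁻¹) *
        fderiv ℝ F u (EuclideanSpace.single i 1)) _ u₀ :=
      hweight.mul (hDF.hasFDerivAt.clm_apply (hasFDerivAt_const _ u₀))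
    simp [hprod.fderiv]
  have hsqrt : √(c u₀ ^ m) ≠ 0 := (Real.sqrt_pos.2 (pow_pos hpos m)).ne'
  simp only [(hflux _).fderiv_eq, hdiv, ← Finset.mul_sum, hg.self_of_nhds, Matrix.det_smul,
    Matrix.det_one, Fintype.card_fin, mul_one,
    laplacian_eq_sum_fderiv_fderiv (EuclideanSpace.basisFun _ ℝ), EuclideanSpace.basisFun_apply]
  field_simp

end ConformalChart

section Stereographic

variable {E : Type*} [NormedAddCommGroup E] [InnerProductSpace ℝ E]

theorem stereoInvFunAux_neg (x w : E) :
    stereoInvFunAux (-x) w = (4 / (‖w‖ ^ 2 + 4)) • (w + (1 - ‖w‖ ^ 2 / 4) • x) := by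
  rw [stereoInvFunAux_apply]
  module

theorem fderiv_stereoInvFunAux_apply (v w a : E) :
    fderiv ℝ (stereoInvFunAux v) w a = (4 / (‖w‖ ^ 2 + 4)) • a -
      (8 * inner ℝ w a / (‖w‖ ^ 2 + 4) ^ 2) • w +
      (16 * inner ℝ w a / (‖w‖ ^ 2 + 4) ^ 2) • v := by
  have hnorm : HasFDerivAt (fun w : E => ‖w‖ ^ 2) (2 • innerSL ℝ w) w :=
    (hasStrictFDerivAt_norm_sq w).hasFDerivAt
  have hne : ‖w‖ ^ 2 + 4 ≠ 0 := by positivity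
  have hderiv : HasFDerivAt (stereoInvFunAux v) _ w :=
    ((hasDerivAt_inv hne).comp_hasFDerivAt w (hnorm.add_const 4)).smul
      (((hasFDerivAt_id w).const_smul (4 : ℝ)).add ((hnorm.sub_const 4).smul_const v))
  rw [hderiv.fderiv]
  simp only [Function.comp_apply, smul_add, neg_smul, add_apply, smul_apply,
    ContinuousLinearMap.id_apply, ContinuousLinearMap.smulRight_apply, coe_innerSL_apply,
    nsmul_eq_mul, Nat.cast_ofNat, neg_apply, smul_eq_mul]
  match_scalars <;> field_simp
  all_goals ring

theorem inner_fderiv_stereoInvFunAux {v w a b : E} (hv : ‖v‖ = 1) (hw : inner ℝ v w = 0)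
    (ha : inner ℝ v a = 0) (hb : inner ℝ v b = 0) :
    inner ℝ (fderiv ℝ (stereoInvFunAux v) w a) (fderiv ℝ (stereoInvFunAux v) w b) =
      (4 / (‖w‖ ^ 2 + 4)) ^ 2 * inner ℝ a b := by
  have hne : ‖w‖ ^ 2 + 4 ≠ 0 := by positivity
  have hw' : inner ℝ w v = 0 := by rw [real_inner_comm, hw]
  have ha' : inner ℝ a v = 0 := by rw [real_inner_comm, ha]
  simp only [fderiv_stereoInvFunAux_apply, inner_add_left, inner_add_right, inner_sub_left,
    inner_sub_right, real_inner_smul_left, real_inner_smul_right, real_inner_self_eq_norm_sq, hv,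
    hw, hw', ha', hb, real_inner_comm w a]
  field_simp
  ring

end Stereographic

section Homogeneous

variable {E F : Type*} [NormedAddCommGroup E] [NormedAddCommGroup F] [NormedSpace ℝ F]

theorem fderiv_apply_self_eq_zero [NormedSpace ℝ E] {G : E → F} {x : E}
    (hG : DifferentiableAt ℝ G x) (hhom : ∀ t : ℝ, 0 < t → G (t • x) = G x) :
    fderiv ℝ G x x = 0 := by
  have hray : HasDerivAt (fun t : ℝ => t • x) x 1 := by
    simpa using (hasDerivAt_id (1 : ℝ)).smul_const x
  have hcomp : HasDerivAt (fun t : ℝ => G (t • x)) (fderiv ℝ G x x) 1 :=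
    HasFDerivAt.comp_hasDerivAt_of_eq 1 hG.hasFDerivAt hray (one_smul ℝ x).symm
  have hconst : (fun t : ℝ => G (t • x)) =ᶠ[𝓝 1] fun _ => G x :=
    (lt_mem_nhds one_pos).mono hhom
  exact hcomp.unique ((hasDerivAt_const _ _).congr_of_eventuallyEq hconst)

theorem fderiv_fderiv_apply_self_self_eq_zero [NormedSpace ℝ E] {G : E → F} {x : E}
    (hG : ContDiffAt ℝ 2 G x) (hhom : ∀ᶠ y in 𝓝 x, ∀ t : ℝ, 0 < t → G (t • y) = G y) :
    fderiv ℝ (fderiv ℝ G) x x x = 0 := by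
  have heuler : (fun y => fderiv ℝ G y y) =ᶠ[𝓝 x] fun _ => 0 := by
    filter_upwards [hhom, hG.eventually (by simp)] with y hy hGy
    exact fderiv_apply_self_eq_zero (hGy.differentiableAt two_ne_zero) hy
  have hDG : DifferentiableAt ℝ (fderiv ℝ G) x :=
    (hG.fderiv_right (m := 1) le_rfl).differentiableAt one_ne_zero
  have hD : fderiv ℝ (fun y => fderiv ℝ G y y) x x = 0 := by simp [heuler.fderiv_eq]
  have hprod : HasFDerivAt (fun y => fderiv ℝ G y y) _ x :=
    hDG.hasFDerivAt.clm_apply (hasFDerivAt_id x)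
  simpa [hprod.fderiv, heuler.self_of_nhds] using hD

variable [InnerProductSpace ℝ E] {m : ℕ}

theorem exists_orthonormalBasis_eq_cons (hE : Module.finrank ℝ E = m + 1) {x : E} (hx : ‖x‖ = 1)
    (L : EuclideanSpace ℝ (Fin m) →ₗᵢ[ℝ] E) (hL : ∀ u, inner ℝ x (L u) = 0) :
    ∃ b : OrthonormalBasis (Fin (m + 1)) ℝ E,
      ⇑b = Fin.cons x fun i => L (EuclideanSpace.single i 1) := by
  have hL' (u) : inner ℝ (L u) x = 0 := by rw [real_inner_comm, hL]
  have hon : Orthonormal ℝ (Fin.cons x fun i => L (EuclideanSpace.single i 1) :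
      Fin (m + 1) → E) := by
    rw [orthonormal_iff_ite]
    refine Fin.cases (Fin.cases ?_ fun j => ?_) fun i => Fin.cases ?_ fun j => ?_
    · simp [hx]
    · simp [hL, (Fin.succ_ne_zero _).symm]
    · simp [hL', Fin.succ_ne_zero]
    · simp [L.inner_map_map, EuclideanSpace.inner_single_left]
  exact ⟨(basisOfOrthonormalOfCardEqFinrank hon (by simp [hE])).toOrthonormalBasis
    (by simpa using hon), by simp⟩

variable [FiniteDimensional ℝ E]

theorem laplacian_eq_sum_tangent {G : E → F} (hE : Module.finrank ℝ E = m + 1) {x : E}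
    (hx : ‖x‖ = 1)
    (L : EuclideanSpace ℝ (Fin m) →ₗᵢ[ℝ] E) (hL : ∀ u, inner ℝ x (L u) = 0)
    (hG : ContDiffAt ℝ 2 G x) (hhom : ∀ᶠ y in 𝓝 x, ∀ t : ℝ, 0 < t → G (t • y) = G y) :
    Δ G x = ∑ i, fderiv ℝ (fderiv ℝ G) x (L (EuclideanSpace.single i 1))
      (L (EuclideanSpace.single i 1)) := by
  obtain ⟨b, hb⟩ := exists_orthonormalBasis_eq_cons hE hx L hL
  simp [laplacian_eq_sum_fderiv_fderiv b, hb, Fin.sum_univ_succ,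
    fderiv_fderiv_apply_self_self_eq_zero hG hhom]

/-- The Laplacian of the paraboloid `u ↦ L u + (1 - ‖u‖² / 4) x` is radial, so it is annihilated by
the differential of `G`. -/
theorem laplacian_comp_paraboloid {G : E → F} (hE : Module.finrank ℝ E = m + 1) {x : E}
    (hx : ‖x‖ = 1) (L : EuclideanSpace ℝ (Fin m) →ₗᵢ[ℝ] E) (hL : ∀ u, inner ℝ x (L u) = 0)
    (hG : ContDiffAt ℝ 2 G x) (hhom : ∀ᶠ y in 𝓝 x, ∀ t : ℝ, 0 < t → G (t • y) = G y) :
    Δ (G ∘ fun u => L u + (1 - ‖u‖ ^ 2 / 4) • x) 0 = Δ G x := by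
  set s : EuclideanSpace ℝ (Fin m) → ℝ := fun u => 1 - ‖u‖ ^ 2 / 4 with hs_def
  set ρ : EuclideanSpace ℝ (Fin m) → E := fun u => L u + s u • x with hρ_def
  have hs : ContDiff ℝ 2 s := contDiff_const.sub ((contDiff_norm_sq ℝ).div_const 4)
  have hrad : ContDiff ℝ 2 fun u => s u • x := hs.smul contDiff_const
  have hρ0 : ρ 0 = x := by simp [hρ_def, hs_def]
  have hρ : ContDiffAt ℝ 2 ρ 0 := (L.contDiff.add hrad).contDiffAt
  have hGρ : ContDiffAt ℝ 2 G (ρ 0) := by rwa [hρ0]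
  have hDρ (v) : fderiv ℝ ρ 0 v = L v := by
    have hDs : HasFDerivAt s (0 : _ →L[ℝ] ℝ) 0 := by
      simpa [hs_def, div_eq_mul_inv] using ((hasStrictFDerivAt_norm_sq
        (0 : EuclideanSpace ℝ (Fin m))).hasFDerivAt.mul_const (4⁻¹ : ℝ)).const_sub 1
    have hD : HasFDerivAt ρ _ 0 := L.toContinuousLinearMap.hasFDerivAt.add (hDs.smul_const x)
    simp [hD.fderiv]
  have hΔρ : Δ ρ 0 = Δ s 0 • x := by
    have hΔL : Δ (L : EuclideanSpace ℝ (Fin m) → E) 0 = 0 :=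
      laplacian_continuousLinearMap L.toContinuousLinearMap 0
    have hΔrad : Δ (fun u => s u • x) 0 = Δ s 0 • x :=
      hs.contDiffAt.laplacian_CLM_comp_left (l := (ContinuousLinearMap.id ℝ ℝ).smulRight x)
    rw [show ρ = L + fun u => s u • x from rfl, L.contDiff.contDiffAt.laplacian_add hrad.contDiffAt,
      hΔL, hΔrad, zero_add]
  have hDG : fderiv ℝ G x x = 0 :=
    fderiv_apply_self_eq_zero (hG.differentiableAt two_ne_zero) hhom.self_of_nhds
  change Δ (G ∘ ρ) 0 = Δ G x
  rw [laplacian_comp (EuclideanSpace.basisFun _ ℝ) hGρ hρ,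
    laplacian_eq_sum_tangent hE hx L hL hG hhom]
  simp only [hρ0, hDρ, hΔρ, map_smul, hDG, smul_zero, add_zero, EuclideanSpace.basisFun_apply]

theorem laplacian_comp_stereoInvFunAux {G : E → F} (hE : Module.finrank ℝ E = m + 1) {x : E}
    (hx : ‖x‖ = 1) (L : EuclideanSpace ℝ (Fin m) →ₗᵢ[ℝ] E) (hL : ∀ u, inner ℝ x (L u) = 0)
    (hG : ContDiffAt ℝ 2 G x) (hhom : ∀ᶠ y in 𝓝 x, ∀ t : ℝ, 0 < t → G (t • y) = G y) :
    Δ (G ∘ stereoInvFunAux (-x) ∘ L) 0 = Δ G x := by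
  have hρ : Filter.Tendsto (fun u => L u + (1 - ‖u‖ ^ 2 / 4) • x) (𝓝 0) (𝓝 x) :=
    Continuous.tendsto' (by fun_prop) 0 x (by simp)
  have hstereo : G ∘ stereoInvFunAux (-x) ∘ L =ᶠ[𝓝 0]
      G ∘ fun u => L u + (1 - ‖u‖ ^ 2 / 4) • x := by
    filter_upwards [hρ.eventually hhom] with u hu
    rw [Function.comp_apply, Function.comp_apply, stereoInvFunAux_neg, L.norm_map,
      hu _ (by positivity), Function.comp_apply]
  rw [(laplacian_congr_nhds hstereo).self_of_nhds, laplacian_comp_paraboloid hE hx L hL hG hhom]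

end Homogeneous

section RoundMetric

variable {m : ℕ} (x₀ : Sphere m)

local instance fact_finrank_euclideanSpace :
    Fact (Module.finrank ℝ (EuclideanSpace ℝ (Fin (m + 1))) = m + 1) :=
  ⟨finrank_euclideanSpace_fin⟩

/-- The identification of the model space of the sphere with the hyperplane orthogonal to `x₀`
which underlies the preferred chart at `x₀`, the stereographic projection from `-x₀`. -/
def tangentIsometry : EuclideanSpace ℝ (Fin m) →ₗᵢ[ℝ] EuclideanSpace ℝ (Fin (m + 1)) :=
  (Submodule.subtypeₗᵢ _).comp (OrthonormalBasis.fromOrthogonalSpanSingleton (𝕜 := ℝ) m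
    (ne_zero_of_mem_unit_sphere (-x₀))).repr.symm.toLinearIsometry

theorem inner_tangentIsometry (u : EuclideanSpace ℝ (Fin m)) :
    inner ℝ (x₀ : EuclideanSpace ℝ (Fin (m + 1))) (tangentIsometry x₀ u) = 0 := by
  have h : tangentIsometry x₀ u ∈
      (Submodule.span ℝ {((-x₀ : Sphere m) : EuclideanSpace ℝ (Fin (m + 1)))})ᗮ :=
    Subtype.property _
  simpa [Submodule.mem_orthogonal_singleton_iff_inner_right] using h

theorem coe_extChartAt_symm (u : EuclideanSpace ℝ (Fin m)) :
    (((extChartAt (𝓡 m) x₀).symm u : Sphere m) : EuclideanSpace ℝ (Fin (m + 1))) =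
      stereoInvFunAux (-x₀.1) (tangentIsometry x₀ u) := rfl

theorem extChartAt_target_eq_univ : (extChartAt (𝓡 m) x₀).target = Set.univ := by
  simp [chartAt, ChartedSpace.chartAt, mfld_simps]

theorem extChartAt_self_eq_zero : extChartAt (𝓡 m) x₀ x₀ = 0 := by
  change (OrthonormalBasis.fromOrthogonalSpanSingleton (𝕜 := ℝ) m
    (ne_zero_of_mem_unit_sphere (-x₀))).repr (stereographic (norm_eq_of_mem_sphere (-x₀)) x₀) = 0
  rw [stereographic_neg_apply, map_zero]

theorem contDiff_coe_extChartAt_symm {k : ℕ∞ω} :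
    ContDiff ℝ k fun u => (((extChartAt (𝓡 m) x₀).symm u : Sphere m) :
      EuclideanSpace ℝ (Fin (m + 1))) :=
  contDiff_stereoInvFunAux.comp (tangentIsometry x₀).contDiff

theorem inclDeriv_coordVector (i : Fin m) (u : EuclideanSpace ℝ (Fin m)) :
    inclDeriv m ((extChartAt (𝓡 m) x₀).symm u) (coordVector x₀ i u) =
      fderiv ℝ (stereoInvFunAux (-x₀.1)) (tangentIsometry x₀ u)
        (tangentIsometry x₀ (EuclideanSpace.single i 1)) := by
  have hchart : MDifferentiableAt (𝓡 m) (𝓡 m) (extChartAt (𝓡 m) x₀).symm u :=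
    ((contMDiffOn_extChartAt_symm (n := 1) x₀).contMDiffAt
      (by rw [extChartAt_target_eq_univ]; exact Filter.univ_mem)).mdifferentiableAt one_ne_zero
  have hcoe : MDifferentiableAt (𝓡 m) 𝓘(ℝ, EuclideanSpace ℝ (Fin (m + 1)))
      (fun y : Sphere m => (y : EuclideanSpace ℝ (Fin (m + 1)))) ((extChartAt (𝓡 m) x₀).symm u) :=
    contMDiff_coe_sphere.mdifferentiableAt one_ne_zero
  have hchain := mfderiv_comp u hcoe hchart
  have hstereo : HasFDerivAt (stereoInvFunAux (-x₀.1) ∘ tangentIsometry x₀) _ u :=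
    (contDiff_stereoInvFunAux.differentiable one_ne_zero _).hasFDerivAt.comp u
      (tangentIsometry x₀).toContinuousLinearMap.hasFDerivAt
  rw [mfderiv_eq_fderiv] at hchain
  exact congrArg (fun A => A (EuclideanSpace.single i (1 : ℝ))) (hchain.symm.trans hstereo.fderiv)

theorem metricMatrix_roundMetric (u : EuclideanSpace ℝ (Fin m)) :
    metricMatrix (roundMetric m) x₀ u =
      (4 / (‖u‖ ^ 2 + 4)) ^ 2 • (1 : Matrix (Fin m) (Fin m) ℝ) := by
  ext i j
  change inner ℝ (inclDeriv m ((extChartAt (𝓡 m) x₀).symm u) (coordVector x₀ i u))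
    (inclDeriv m ((extChartAt (𝓡 m) x₀).symm u) (coordVector x₀ j u)) = _
  rw [inclDeriv_coordVector, inclDeriv_coordVector, inner_fderiv_stereoInvFunAux
    (by simp) (by simp [inner_tangentIsometry]) (by simp [inner_tangentIsometry])
    (by simp [inner_tangentIsometry])]
  simp [EuclideanSpace.inner_single_left, Matrix.one_apply]

theorem laplaceBeltrami_roundMetric {f : Sphere m → ℝ}
    (hf : ContDiffAt ℝ 2 (f ∘ (extChartAt (𝓡 m) x₀).symm) 0) :
    laplaceBeltrami (roundMetric m) f x₀ = Δ (f ∘ (extChartAt (𝓡 m) x₀).symm) 0 := by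
  have hfactor : HasFDerivAt (fun u : EuclideanSpace ℝ (Fin m) => (4 / (‖u‖ ^ 2 + 4)) ^ 2)
      (0 : _ →L[ℝ] ℝ) 0 := by
    have hnorm : HasFDerivAt (fun u : EuclideanSpace ℝ (Fin m) => ‖u‖ ^ 2) (0 : _ →L[ℝ] ℝ) 0 := by
      simpa using (hasStrictFDerivAt_norm_sq (0 : EuclideanSpace ℝ (Fin m))).hasFDerivAt
    have hdiff : DifferentiableAt ℝ (fun s : ℝ => (4 / (s + 4)) ^ 2)
        (‖(0 : EuclideanSpace ℝ (Fin m))‖ ^ 2) := by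
      fun_prop (disch := positivity)
    have hcomp := hdiff.hasDerivAt.comp_hasFDerivAt 0 hnorm
    rwa [smul_zero] at hcomp
  have h := laplaceBeltrami_eq_laplacian_of_metricMatrix_eq_smul (f := f) (x₀ := x₀)
    (.of_forall (metricMatrix_roundMetric x₀)) (by positivity)
    (by rwa [extChartAt_self_eq_zero]) (by rwa [extChartAt_self_eq_zero])
  rw [extChartAt_self_eq_zero] at h
  simpa using h

variable {x₀}

theorem laplaceBeltrami_roundMetric_eq_laplacian {f : Sphere m → ℝ}
    {G : EuclideanSpace ℝ (Fin (m + 1)) → ℝ} (hG : ContDiffAt ℝ 2 G x₀)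
    (hfG : ∀ᶠ y in 𝓝 x₀, f y = G y)
    (hhom : ∀ᶠ y in 𝓝 (x₀ : EuclideanSpace ℝ (Fin (m + 1))), ∀ t : ℝ, 0 < t → G (t • y) = G y) :
    laplaceBeltrami (roundMetric m) f x₀ = Δ G x₀ := by
  have hσ0 : (extChartAt (𝓡 m) x₀).symm 0 = x₀ := by
    rw [← extChartAt_self_eq_zero x₀, extChartAt_to_inv]
  have hσ : Filter.Tendsto (extChartAt (𝓡 m) x₀).symm (𝓝 0) (𝓝 x₀) :=
    (continuous_induced_rng.2 (contDiff_coe_extChartAt_symm (k := 0) x₀).continuous).tendsto' 0 x₀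
      hσ0
  have hfσ : f ∘ (extChartAt (𝓡 m) x₀).symm =ᶠ[𝓝 0]
      G ∘ stereoInvFunAux (-x₀.1) ∘ tangentIsometry x₀ := hσ.eventually hfG
  have hsmooth : ContDiffAt ℝ 2 (G ∘ stereoInvFunAux (-x₀.1) ∘ tangentIsometry x₀) 0 :=
    ContDiffAt.comp 0 (by rwa [Function.comp_apply, ← coe_extChartAt_symm, hσ0])
      (contDiff_coe_extChartAt_symm x₀).contDiffAt
  rw [laplaceBeltrami_roundMetric x₀ (hsmooth.congr_of_eventuallyEq hfσ),
    (laplacian_congr_nhds hfσ).self_of_nhds,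
    laplacian_comp_stereoInvFunAux finrank_euclideanSpace_fin (by simp) (tangentIsometry x₀)
      (inner_tangentIsometry x₀) hG hhom]

theorem isHarmonicMorphismOn_roundMetric {U : Set (EuclideanSpace ℝ (Fin (m + 1)))}
    {Ψ : EuclideanSpace ℝ (Fin (m + 1)) → ℂ} {Φ : Sphere m → ℂ} (hU : IsOpen U)
    (hΨ : ContDiffOn ℝ ∞ Ψ U) (hhom : ∀ y ∈ U, ∀ t : ℝ, 0 < t → Ψ (t • y) = Ψ y)
    (hharm : ∀ y ∈ U, ∀ f : ℂ → ℝ, HarmonicAt f (Ψ y) → Δ (f ∘ Ψ) y = 0)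
    (hΦ : ∀ y : Sphere m, y.1 ∈ U → Φ y = Ψ y) :
    IsHarmonicMorphismOn (roundMetric m) Φ (Subtype.val ⁻¹' U) := by
  have hΦs : ContMDiffOn (𝓡 m) 𝓘(ℝ, ℂ) ∞ Φ (Subtype.val ⁻¹' U) :=
    (hΨ.contMDiffOn.comp contMDiff_coe_sphere.contMDiffOn fun _ hy => hy).congr hΦ
  refine ⟨hΦs, fun W f _ hf => ⟨?_, ?_⟩⟩
  · exact hf.contDiffOn.contMDiffOn.comp
      ((hΦs.of_le (WithTop.coe_le_coe.2 le_top)).mono Set.inter_subset_left) fun _ hy => hy.2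
  · rintro y ⟨hyU, hyW⟩
    have hfy : HarmonicAt f (Ψ y) := hf _ (hΦ y hyU ▸ hyW)
    have hΨy : ContDiffAt ℝ 2 Ψ y :=
      (hΨ.contDiffAt (hU.mem_nhds hyU)).of_le (WithTop.coe_le_coe.2 le_top)
    have hfΦ : ∀ᶠ z in 𝓝 y, (f ∘ Φ) z = (f ∘ Ψ) z :=
      ((hU.preimage continuous_subtype_val).eventually_mem hyU).mono fun z hz =>
        congrArg f (hΦ z hz)
    have hhomy : ∀ᶠ z in 𝓝 y.1, ∀ t : ℝ, 0 < t → (f ∘ Ψ) (t • z) = (f ∘ Ψ) z :=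
      (hU.eventually_mem hyU).mono fun z hz t ht => congrArg f (hhom z hz t ht)
    rw [laplaceBeltrami_roundMetric_eq_laplacian (hfy.1.comp _ hΨy) hfΦ hhomy, hharm y hyU f hfy]

end RoundMetric

section Polynomial

open MvPolynomial

variable {σ 𝕜 : Type*}

theorem eval_smul_of_isHomogeneous [CommSemiring 𝕜] {p : MvPolynomial σ 𝕜} {k : ℕ}
    (hp : p.IsHomogeneous k) (c : 𝕜) (x : σ → 𝕜) : eval (c • x) p = c ^ k * eval x p := by
  rw [eval_eq, eval_eq, Finset.mul_sum]
  refine Finset.sum_congr rfl fun s hs => ?_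
  have hdeg : ∑ i ∈ s.support, s i = k := by
    rw [← Finsupp.degree_apply, Finsupp.degree_eq_weight_one]
    exact hp (mem_support_iff.1 hs)
  simp only [Pi.smul_apply, smul_eq_mul, mul_pow, Finset.prod_mul_distrib,
    Finset.prod_pow_eq_pow_sum, hdeg]
  ring

variable [NontriviallyNormedField 𝕜]

theorem hasFDerivAt_eval [Fintype σ] (p : MvPolynomial σ 𝕜) (x : σ → 𝕜) :
    HasFDerivAt (fun x => eval x p)
      (∑ k, eval x (pderiv k p) • (ContinuousLinearMap.proj k : (σ → 𝕜) →L[𝕜] 𝕜)) x := by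
  classical
  induction p using MvPolynomial.induction_on with
  | C a =>
    have hconst : HasFDerivAt (fun _ => a) (0 : (σ → 𝕜) →L[𝕜] 𝕜) x := hasFDerivAt_const a x
    simp only [eval_C]
    convert! hconst using 1
    ext v
    simp
  | add p q hp hq =>
    simp only [map_add]
    convert! hp.add hq using 1
    ext v
    simp [add_mul, Finset.sum_add_distrib]
  | mul_X p i hp =>
    have hprod := hp.mul (ContinuousLinearMap.proj i : (σ → 𝕜) →L[𝕜] 𝕜).hasFDerivAt
    simp only [map_mul, eval_X]
    convert! hprod using 1
    ext v
    simp [Derivation.leibniz, pderiv_X, add_mul, Finset.sum_add_distrib, Finset.mul_sum,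
      Pi.single_apply, mul_assoc, apply_ite]

variable [Finite σ] [DecidableEq σ]

theorem fderiv_eval_single (p : MvPolynomial σ 𝕜) (x : σ → 𝕜) (k : σ) :
    fderiv 𝕜 (fun x => eval x p) x (Pi.single k 1) = eval x (pderiv k p) := by
  cases nonempty_fintype σ
  simp [(hasFDerivAt_eval p x).fderiv, Pi.single_apply]

theorem fderiv_fderiv_eval_single [CompleteSpace 𝕜] (p : MvPolynomial σ 𝕜) (x : σ → 𝕜) (k l : σ) :
    fderiv 𝕜 (fderiv 𝕜 fun x => eval x p) x (Pi.single k 1) (Pi.single l 1) =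
      eval x (pderiv k (pderiv l p)) := by
  cases nonempty_fintype σ
  have hD : DifferentiableAt 𝕜 (fderiv 𝕜 fun x => eval x p) x :=
    (AnalyticOnNhd.eval_mvPolynomial p x trivial).fderiv.differentiableAt
  have happly : HasFDerivAt (fun y => fderiv 𝕜 (fun x => eval x p) y (Pi.single l 1)) _ x :=
    hD.hasFDerivAt.clm_apply (hasFDerivAt_const _ x)
  rw [← fderiv_eval_single]
  simp_rw [← fderiv_eval_single p]
  simp [happly.fderiv]

end Polynomial

section HalfPow

variable (d : ℕ)

theorem analyticAt_halfPow {w : ℂ} (hw : Odd d → w ∈ Complex.slitPlane) :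
    AnalyticAt ℂ (halfPow d) w := by
  rcases d.even_or_odd with hd | hd
  · have heq : halfPow d = fun w => w ^ (d / 2) := funext fun w => if_pos hd
    rw [heq]
    fun_prop
  · have heq : halfPow d = fun w => (w ^ (1 / 2 : ℂ)) ^ d :=
      funext fun w => if_neg (Nat.not_even_iff_odd.2 hd)
    rw [heq]
    exact (analyticAt_id.cpow analyticAt_const (hw hd)).pow d

theorem sq_mul_cpow_half {t : ℝ} (ht : 0 < t) (w : ℂ) :
    ((t : ℂ) ^ 2 * w) ^ (1 / 2 : ℂ) = t * w ^ (1 / 2 : ℂ) := by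
  rcases eq_or_ne w 0 with rfl | hw
  · simp
  have ht0 : (t : ℂ) ≠ 0 := Complex.ofReal_ne_zero.2 ht.ne'
  have hlog : Complex.log ((t : ℂ) ^ 2 * w) = 2 * Complex.log t + Complex.log w := by
    rw [← Complex.ofReal_pow, Complex.log_ofReal_mul (by positivity) hw, Real.log_pow,
      ← Complex.ofReal_log ht.le]
    push_cast
    rfl
  rw [Complex.cpow_def_of_ne_zero (mul_ne_zero (pow_ne_zero 2 ht0) hw),
    Complex.cpow_def_of_ne_zero hw, hlog, add_mul, Complex.exp_add, mul_one_div,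
    mul_div_cancel_left₀ _ (two_ne_zero' ℂ), Complex.exp_log ht0]

theorem halfPow_sq_mul {t : ℝ} (ht : 0 < t) (w : ℂ) :
    halfPow d ((t : ℂ) ^ 2 * w) = (t : ℂ) ^ d * halfPow d w := by
  rcases d.even_or_odd with hd | hd
  · simp only [halfPow, if_pos hd, mul_pow, ← pow_mul, Nat.mul_div_cancel' hd.two_dvd]
  · simp only [halfPow, if_neg (Nat.not_even_iff_odd.2 hd), sq_mul_cpow_half ht, mul_pow]

end HalfPow

section Coordinates

theorem sum_fin_two_mul_add_three {A : Type*} [AddCommMonoid A] (n : ℕ)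
    (a : Fin (2 * n + 2 + 1) → A) :
    ∑ i, a i = ∑ k : Fin 3, a ⟨k, by omega⟩ +
      ∑ k : Fin n, (a ⟨2 * k + 3, by omega⟩ + a ⟨2 * k + 4, by omega⟩) := by
  induction n with
  | zero => simp
  | succ n ih =>
    refine (Fin.sum_univ_castSucc (n := 2 * n + 2 + 1 + 1) a).trans ?_
    rw [Fin.sum_univ_castSucc, ih, Fin.sum_univ_castSucc (n := n)]
    simp only [add_assoc]
    rfl

variable (n : ℕ)

/-- The identification `ℝ^(2n+3) ≅ ℝ³ × ℂⁿ` as a real linear map, with `ℝ³` embedded in `ℂ³` so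
that complex polynomials can be evaluated. -/
def coordCLM : EuclideanSpace ℝ (Fin (2 * n + 2 + 1)) →L[ℝ] (Fin 3 → ℂ) × (Fin n → ℂ) :=
  LinearMap.toContinuousLinearMap
    { toFun := fun x => (realPart n x, complexPart n x)
      map_add' := fun x y => by
        ext k <;> simp [realPart, complexPart]
        ring
      map_smul' := fun t x => by
        ext k <;> simp [realPart, complexPart]
        ring }

variable {n}

theorem coordCLM_apply (x : EuclideanSpace ℝ (Fin (2 * n + 2 + 1))) :
    coordCLM n x = (realPart n x, complexPart n x) := rfl

theorem realPart_smul (t : ℝ) (x : EuclideanSpace ℝ (Fin (2 * n + 2 + 1))) :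
    realPart n (t • x) = (t : ℂ) • realPart n x :=
  congrArg Prod.fst ((coordCLM n).map_smul t x)

theorem complexPart_smul (t : ℝ) (x : EuclideanSpace ℝ (Fin (2 * n + 2 + 1))) :
    complexPart n (t • x) = (t : ℂ) • complexPart n x :=
  congrArg Prod.snd ((coordCLM n).map_smul t x)

theorem coordCLM_single_real (k : Fin 3) :
    coordCLM n (EuclideanSpace.single ⟨k, by omega⟩ 1) = (Pi.single k 1, 0) := by
  ext j
  · simp [coordCLM_apply, realPart, Pi.single_apply, Fin.val_inj, apply_ite]
  · have hre : ¬ 2 * (j : ℕ) + 3 = k := by omega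
    have him : ¬ 2 * (j : ℕ) + 4 = k := by omega
    simp [coordCLM_apply, complexPart, hre, him]

theorem coordCLM_single_re (k : Fin n) :
    coordCLM n (EuclideanSpace.single ⟨2 * k + 3, by omega⟩ 1) = (0, Pi.single k 1) := by
  ext j
  · have hj : ¬ (j : ℕ) = 2 * k + 3 := by omega
    simp [coordCLM_apply, realPart, hj]
  · have him : ¬ 2 * (j : ℕ) + 4 = 2 * k + 3 := by omega
    simp [coordCLM_apply, complexPart, him, Pi.single_apply, Fin.val_inj, apply_ite]

theorem coordCLM_single_im (k : Fin n) :
    coordCLM n (EuclideanSpace.single ⟨2 * k + 4, by omega⟩ 1) =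
      Complex.I • (0, Pi.single k 1) := by
  ext j
  · have hj : ¬ (j : ℕ) = 2 * k + 4 := by omega
    simp [coordCLM_apply, realPart, hj]
  · have hre : ¬ 2 * (j : ℕ) = 2 * k + 1 := by omega
    by_cases hjk : j = k <;> simp [coordCLM_apply, complexPart, hre, hjk, Fin.val_inj]

/-- The real and imaginary directions of each `zₖ` contribute `B v v` and `B (iv) (iv) = -B v v`. -/
theorem sum_bilin_coordCLM
    (B : (Fin 3 → ℂ) × (Fin n → ℂ) →L[ℂ] (Fin 3 → ℂ) × (Fin n → ℂ) →L[ℂ] ℂ) :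
    ∑ i, B (coordCLM n (EuclideanSpace.single i 1)) (coordCLM n (EuclideanSpace.single i 1)) =
      ∑ k, B (Pi.single k 1, 0) (Pi.single k 1, 0) := by
  have hcancel (v) : B v v + B (Complex.I • v) (Complex.I • v) = 0 := by
    simp [← mul_assoc]
  simp only [sum_fin_two_mul_add_three, coordCLM_single_real, coordCLM_single_re,
    coordCLM_single_im, hcancel, Finset.sum_const_zero, add_zero]

end Coordinates

section ConformalHarmonicQuadratic

variable {n : ℕ} {p : MvPolynomial (Fin 3) ℂ}

/-- The map `(x, z) ↦ (p(x), z)` through which `(p^(d/2) + P) / Q` factors. -/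
def quadraticCoord (n : ℕ) (p : MvPolynomial (Fin 3) ℂ)
    (x : EuclideanSpace ℝ (Fin (2 * n + 2 + 1))) : ℂ × (Fin n → ℂ) :=
  (MvPolynomial.eval (realPart n x) p, complexPart n x)

variable (x : EuclideanSpace ℝ (Fin (2 * n + 2 + 1)))

theorem contDiff_quadraticCoord {k : ℕ∞ω} : ContDiff ℝ k (quadraticCoord n p) :=
  (((AnalyticOnNhd.eval_mvPolynomial p).contDiff.restrict_scalars ℝ).comp
    (coordCLM n).contDiff.fst).prodMk (coordCLM n).contDiff.snd

theorem fderiv_quadraticCoord (v : EuclideanSpace ℝ (Fin (2 * n + 2 + 1))) :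
    fderiv ℝ (quadraticCoord n p) x v =
      (fderiv ℂ (fun X => MvPolynomial.eval X p) (realPart n x) (coordCLM n v).1,
        (coordCLM n v).2) := by
  have hp : HasFDerivAt (𝕜 := ℝ) (fun X => MvPolynomial.eval X p) _ (coordCLM n x).1 :=
    (AnalyticOnNhd.eval_mvPolynomial p _ trivial).differentiableAt.hasFDerivAt.restrictScalars ℝ
  have hφ : HasFDerivAt (quadraticCoord n p) _ x :=
    (hp.comp x (coordCLM n).hasFDerivAt.fst).prodMk (coordCLM n).hasFDerivAt.snd
  rw [hφ.fderiv]
  rfl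

theorem isIsotropicAt_quadraticCoord
    (hp : ∑ k, MvPolynomial.pderiv k p * MvPolynomial.pderiv k p = 0) :
    IsIsotropicAt (EuclideanSpace.basisFun _ ℝ) (quadraticCoord n p) x := by
  intro B
  set D := (fderiv ℂ (fun X => MvPolynomial.eval X p) (realPart n x)).prodMap
    (ContinuousLinearMap.id ℂ (Fin n → ℂ)) with hD
  have hDk (k : Fin 3) : D (Pi.single k 1, 0) =
      MvPolynomial.eval (realPart n x) (MvPolynomial.pderiv k p) • ((1, 0) : ℂ × (Fin n → ℂ)) := by
    simp [hD, fderiv_eval_single]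
  calc ∑ i, B (fderiv ℝ (quadraticCoord n p) x (EuclideanSpace.basisFun _ ℝ i))
        (fderiv ℝ (quadraticCoord n p) x (EuclideanSpace.basisFun _ ℝ i))
    _ = ∑ i, B.bilinearComp D D (coordCLM n (EuclideanSpace.single i 1))
        (coordCLM n (EuclideanSpace.single i 1)) := by
      simp [fderiv_quadraticCoord, hD, Prod.map]
    _ = ∑ k, B (D (Pi.single k 1, 0)) (D (Pi.single k 1, 0)) := sum_bilin_coordCLM _
    _ = MvPolynomial.eval (realPart n x)
        (∑ k, MvPolynomial.pderiv k p * MvPolynomial.pderiv k p) * B (1, 0) (1, 0) := by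
      simp only [hDk, map_smul, smul_apply, smul_eq_mul, map_sum, map_mul, Finset.sum_mul,
        mul_assoc]
    _ = 0 := by rw [hp, map_zero, zero_mul]

theorem laplacian_eval_realPart :
    Δ (fun x => MvPolynomial.eval (realPart n x) p) x =
      MvPolynomial.eval (realPart n x)
        (∑ k, MvPolynomial.pderiv k (MvPolynomial.pderiv k p)) := by
  set L := (ContinuousLinearMap.fst ℝ _ _).comp (coordCLM n)
  have hp : AnalyticAt ℂ (fun X => MvPolynomial.eval X p) (L x) :=
    AnalyticOnNhd.eval_mvPolynomial p _ trivial
  have hpL : ContDiffAt ℝ 2 (fun X => MvPolynomial.eval X p) (L x) :=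
    hp.contDiffAt.restrict_scalars ℝ
  change Δ ((fun X => MvPolynomial.eval X p) ∘ L) x = _
  rw [laplacian_comp (EuclideanSpace.basisFun _ ℝ) hpL L.contDiff.contDiffAt,
    laplacian_continuousLinearMap, map_zero, add_zero, L.fderiv]
  simp only [EuclideanSpace.basisFun_apply, fderiv_fderiv_restrictScalars_apply hp]
  refine (sum_bilin_coordCLM ((fderiv ℂ (fderiv ℂ fun X => MvPolynomial.eval X p)
    (L x)).bilinearComp (.fst ℂ _ _) (.fst ℂ _ (Fin n → ℂ)))).trans ?_
  simp only [ContinuousLinearMap.bilinearComp_apply, ContinuousLinearMap.coe_fst',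
    fderiv_fderiv_eval_single, map_sum]
  rfl

theorem laplacian_quadraticCoord
    (hp : ∑ k, MvPolynomial.pderiv k (MvPolynomial.pderiv k p) = 0) :
    Δ (quadraticCoord n p) x = 0 := by
  have hφ := (contDiff_quadraticCoord (n := n) (p := p) (k := 2)).contDiffAt (x := x)
  have hz : Δ (complexPart n) x = 0 :=
    laplacian_continuousLinearMap ((ContinuousLinearMap.snd ℝ _ _).comp (coordCLM n)) x
  exact (laplacian_prodMk hφ.fst hφ.snd).trans
    (Prod.ext ((laplacian_eval_realPart x).trans (by rw [hp, map_zero]; rfl)) hz)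

end ConformalHarmonicQuadratic

section Quotient

variable {n d : ℕ} {p : MvPolynomial (Fin 3) ℂ} {P Q : MvPolynomial (Fin n) ℂ}
  {x : EuclideanSpace ℝ (Fin (2 * n + 2 + 1))}

/-- The map `(w, z) ↦ (w^(d/2) + P(z)) / Q(z)`, the outer factor of `(p^(d/2) + P) / Q`. -/
def halfPowQuotient (d : ℕ) (P Q : MvPolynomial (Fin n) ℂ) (v : ℂ × (Fin n → ℂ)) : ℂ :=
  (halfPow d v.1 + MvPolynomial.eval v.2 P) / MvPolynomial.eval v.2 Q

theorem analyticAt_halfPowQuotient {v : ℂ × (Fin n → ℂ)}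
    (hQ : MvPolynomial.eval v.2 Q ≠ 0) (hw : Odd d → v.1 ∈ Complex.slitPlane) :
    AnalyticAt ℂ (halfPowQuotient d P Q) v := by
  have heval (R : MvPolynomial (Fin n) ℂ) :
      AnalyticAt ℂ (fun v : ℂ × (Fin n → ℂ) => MvPolynomial.eval v.2 R) v :=
    AnalyticOnNhd.eval_continuousLinearMap (.snd ℂ ℂ (Fin n → ℂ)) R v trivial
  exact (((analyticAt_halfPow d hw).comp analyticAt_fst).add (heval P)).div (heval Q) hQ

theorem hatPhi_eq_comp :
    hatPhi n d p P Q = halfPowQuotient d P Q ∘ quadraticCoord n p := rfl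

theorem analyticAt_halfPowQuotient_quadraticCoord (hx : x ∈ hatDomain n d p Q) :
    AnalyticAt ℂ (halfPowQuotient d P Q) (quadraticCoord n p x) :=
  analyticAt_halfPowQuotient hx.1 hx.2

theorem contDiffOn_hatPhi {k : ℕ∞ω} : ContDiffOn ℝ k (hatPhi n d p P Q) (hatDomain n d p Q) := by
  intro x hx
  rw [hatPhi_eq_comp]
  have hR : ContDiffAt ℝ k (halfPowQuotient d P Q) (quadraticCoord n p x) :=
    (analyticAt_halfPowQuotient_quadraticCoord hx).restrictScalars.contDiffAt
  exact (hR.comp x contDiff_quadraticCoord.contDiffAt).contDiffWithinAt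

theorem laplacian_harmonic_comp_hatPhi (hp : IsConformalHarmonicQuadratic p)
    (hx : x ∈ hatDomain n d p Q) {f : ℂ → ℝ} (hf : HarmonicAt f (hatPhi n d p P Q x)) :
    Δ (f ∘ hatPhi n d p P Q) x = 0 := by
  rw [hatPhi_eq_comp]
  exact laplacian_harmonic_comp_eq_zero contDiff_quadraticCoord.contDiffAt
    (laplacian_quadraticCoord x hp.harmonic) (isIsotropicAt_quadraticCoord x hp.conformal)
    (analyticAt_halfPowQuotient_quadraticCoord hx) hf

theorem isOpen_hatDomain : IsOpen (hatDomain n d p Q) := by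
  have hφ : Continuous (quadraticCoord n p) := (contDiff_quadraticCoord (k := 0)).continuous
  have hQ : Continuous fun x => MvPolynomial.eval (complexPart n x) Q :=
    (MvPolynomial.continuous_eval Q).comp hφ.snd
  have hslit : IsOpen {x | Odd d → MvPolynomial.eval (realPart n x) p ∈ Complex.slitPlane} := by
    by_cases hd : Odd d
    · simpa only [hd, forall_const] using! Complex.isOpen_slitPlane.preimage hφ.fst
    · simp [hd]
  exact (isOpen_ne_fun hQ continuous_const).inter hslit

theorem smul_mem_hatDomain (hp : p.IsHomogeneous 2) (hQ : Q.IsHomogeneous d) {t : ℝ} (ht : 0 < t)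
    (hx : x ∈ hatDomain n d p Q) : t • x ∈ hatDomain n d p Q := by
  constructor
  · rw [complexPart_smul, eval_smul_of_isHomogeneous hQ]
    exact mul_ne_zero (pow_ne_zero d (Complex.ofReal_ne_zero.2 ht.ne')) hx.1
  · intro hd
    rw [realPart_smul, eval_smul_of_isHomogeneous hp, ← Complex.ofReal_pow,
      Complex.mem_slitPlane_iff, Complex.re_ofReal_mul, Complex.im_ofReal_mul]
    exact (hx.2 hd).imp (mul_pos (pow_pos ht 2)) (mul_ne_zero (pow_pos ht 2).ne')

theorem hatPhi_smul (hp : p.IsHomogeneous 2) (hP : P.IsHomogeneous d) (hQ : Q.IsHomogeneous d)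
    {t : ℝ} (ht : 0 < t) (x : EuclideanSpace ℝ (Fin (2 * n + 2 + 1))) :
    hatPhi n d p P Q (t • x) = hatPhi n d p P Q x := by
  have htd : (t : ℂ) ^ d ≠ 0 := pow_ne_zero d (Complex.ofReal_ne_zero.2 ht.ne')
  simp only [hatPhi, complexPart_smul, realPart_smul, eval_smul_of_isHomogeneous hQ,
    eval_smul_of_isHomogeneous hP, eval_smul_of_isHomogeneous hp, halfPow_sq_mul d ht]
  rw [← mul_add, mul_div_mul_left _ _ htd]

theorem zero_notMem_hatDomain (hd : 0 < d) (hQ : Q.IsHomogeneous d) :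
    (0 : EuclideanSpace ℝ (Fin (2 * n + 2 + 1))) ∉ hatDomain n d p Q := by
  have hQ0 : MvPolynomial.eval (complexPart n 0) Q = 0 := by
    have h := complexPart_smul 0 (0 : EuclideanSpace ℝ (Fin (2 * n + 2 + 1)))
    rw [zero_smul] at h
    rw [h, eval_smul_of_isHomogeneous hQ, Complex.ofReal_zero, zero_pow hd.ne', zero_mul]
  exact fun h => h.1 hQ0

end Quotient

section InducedMap

theorem coe_radialProj {m : ℕ} (x : {x : EuclideanSpace ℝ (Fin (m + 1)) // x ≠ 0}) :
    (radialProj m x : EuclideanSpace ℝ (Fin (m + 1))) = ‖x.1‖⁻¹ • x.1 := rfl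

theorem radialProj_coe {m : ℕ} (y : Sphere m) (hy : y.1 ≠ 0) : radialProj m ⟨y.1, hy⟩ = y :=
  Subtype.ext (by simp [coe_radialProj])

variable {n d : ℕ} {p : MvPolynomial (Fin 3) ℂ} {P Q : MvPolynomial (Fin n) ℂ}

theorem sphereDomain_eq_preimage (hd : 0 < d) (hp : p.IsHomogeneous 2) (hQ : Q.IsHomogeneous d) :
    sphereDomain n d p Q = Subtype.val ⁻¹' hatDomain n d p Q := by
  ext y
  constructor
  · rintro ⟨x, hx, rfl⟩
    exact smul_mem_hatDomain hp hQ (inv_pos.2 (norm_pos_iff.2 x.2)) hx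
  · intro hy
    exact ⟨⟨y.1, ne_of_mem_of_not_mem hy (zero_notMem_hatDomain hd hQ)⟩, hy, radialProj_coe y _⟩

theorem isInducedMap_iff (hd : 0 < d) (hp : p.IsHomogeneous 2) (hP : P.IsHomogeneous d)
    (hQ : Q.IsHomogeneous d) {Φ : Sphere (2 * n + 2) → ℂ} :
    IsInducedMap n d p P Q Φ ↔
      ∀ y : Sphere (2 * n + 2), y.1 ∈ hatDomain n d p Q → Φ y = hatPhi n d p P Q y := by
  constructor
  · intro h y hy
    have hπ := h ⟨y.1, ne_of_mem_of_not_mem hy (zero_notMem_hatDomain hd hQ)⟩ hy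
    rwa [radialProj_coe] at hπ
  · intro h x hx
    have hnorm : 0 < ‖x.1‖⁻¹ := inv_pos.2 (norm_pos_iff.2 x.2)
    rw [h (radialProj _ x) (smul_mem_hatDomain hp hQ hnorm hx), coe_radialProj,
      hatPhi_smul hp hP hQ hnorm]

end InducedMap

end SphereHM

end

theorem mainTheorem3 (n d : ℕ) (hn : 0 < n) (hd : 0 < d)
    (p : MvPolynomial (Fin 3) ℂ) (hp : SphereHM.IsConformalHarmonicQuadratic p)
    (P Q : MvPolynomial (Fin n) ℂ) (hP : P.IsHomogeneous d) (hQ : Q.IsHomogeneous d) :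
    (0 : EuclideanSpace ℝ (Fin (2 * n + 2 + 1))) ∉ SphereHM.hatDomain n d p Q ∧
    (∀ t : ℝ, 0 < t → ∀ x ∈ SphereHM.hatDomain n d p Q,
      t • x ∈ SphereHM.hatDomain n d p Q ∧
        SphereHM.hatPhi n d p P Q (t • x) = SphereHM.hatPhi n d p P Q x) ∧
    IsOpen (SphereHM.sphereDomain n d p Q) ∧
    (∃ Φ : SphereHM.Sphere (2 * n + 2) → ℂ, SphereHM.IsInducedMap n d p P Q Φ) ∧
    ∀ Φ : SphereHM.Sphere (2 * n + 2) → ℂ, SphereHM.IsInducedMap n d p P Q Φ →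
      SphereHM.IsHarmonicMorphismOn (SphereHM.roundMetric (2 * n + 2)) Φ
        (SphereHM.sphereDomain n d p Q) := by
  have hhom : ∀ t : ℝ, 0 < t → ∀ x, SphereHM.hatPhi n d p P Q (t • x) =
      SphereHM.hatPhi n d p P Q x := fun _ => SphereHM.hatPhi_smul hp.homogeneous hP hQ
  have hinduced {Φ : SphereHM.Sphere (2 * n + 2) → ℂ} :=
    SphereHM.isInducedMap_iff (Φ := Φ) hd hp.homogeneous hP hQ
  rw [SphereHM.sphereDomain_eq_preimage hd hp.homogeneous hQ]
  refine ⟨SphereHM.zero_notMem_hatDomain hd hQ, fun t ht x hx =>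
      ⟨SphereHM.smul_mem_hatDomain hp.homogeneous hQ ht hx, hhom t ht x⟩,
    SphereHM.isOpen_hatDomain.preimage continuous_subtype_val,
    ⟨fun y => SphereHM.hatPhi n d p P Q y, hinduced.2 fun _ _ => rfl⟩, fun Φ hΦ => ?_⟩
  exact SphereHM.isHarmonicMorphismOn_roundMetric SphereHM.isOpen_hatDomain
    SphereHM.contDiffOn_hatPhi (fun y _ t ht => hhom t ht y)
    (fun y hy f => SphereHM.laplacian_harmonic_comp_hatPhi hp hy) (hinduced.1 hΦ)
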